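/- Triangle Criterion. An $n$-qubit state is a density matrix $\rho$ on $(\mathbb{C}^2)^{\otimes n}$. A stabilizer pure state is a state of the form $U|0^n\rangle\langle 0^n|U^\dagger$ with $U$ an $n$-qubit Clifford unitary (a unitary that normalizes the $n$-qubit Pauli group). A state is a magic state if it is not a mixture (convex combination) of stabilizer pure states. Let $\rho$ be any $n$-qubit state. If there exist three stabilizer pure states $\psi_1,\psi_2,\psi_3$ with $\mathrm{Tr}(\psi_i\psi_j)=1/2$ for all $i\neq j$ such that $$\mathrm{Tr}(\rho\psi_1)>\mathrm{Tr}(\rho\psi_2)+\mathrm{Tr}(\rho\psi_3),$$ then $\rho$ is not a mixture of stabilizer pure states. Moreover, this criterion detects all single-qubit (mixed or pure) magic states and all pure magic states of any number $n$ of qubits: for every such magic state $\rho$ there exist three stabilizer pure states $\psi_1,\psi_2,\psi_3$ with $\mathrm{Tr}(\psi_i\psi_j)=1/2$ for all $i\neq j$ and $\mathrm{Tr}(\rho\psi_1)>\mathrm{Tr}(\rho\psi_2)+\mathrm{Tr}(\rho\psi_3)$. -/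

import Mathlib

open scoped ComplexOrder

namespace Qubit

/-- Basis labels (bit strings) of the `n`-qubit Hilbert space `(ℂ²)^{⊗ n}`. -/
abbrev Bits (n : ℕ) : Type := Fin n → Fin 2

/-- Operators on `n` qubits, as matrices in the computational basis. -/
abbrev Op (n : ℕ) : Type := Matrix (Bits n) (Bits n) ℂ

/-- The rank-one operator `|v⟩⟨v|`. -/
def ketbra {n : ℕ} (v : Bits n → ℂ) : Op n := Matrix.vecMulVec v (star v)

/-- Quantum states (density matrices) of `n` qubits. -/
def IsState {n : ℕ} (ρ : Op n) : Prop := ρ.PosSemidef ∧ ρ.trace = 1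

/-- Pure states of `n` qubits: `|v⟩⟨v|` for a unit vector `v`. -/
def IsPureState {n : ℕ} (ρ : Op n) : Prop :=
  ∃ v : Bits n → ℂ, (∑ b, ‖v b‖ ^ 2) = 1 ∧ ρ = ketbra v

/-- The four Pauli matrices `I, X, Y, Z`. -/
noncomputable def pauli : Fin 4 → Matrix (Fin 2) (Fin 2) ℂ :=
  ![1, !![0, 1; 1, 0], !![0, -Complex.I; Complex.I, 0], !![1, 0; 0, -1]]

/-- The Pauli string `σ_{s 0} ⊗ ⋯ ⊗ σ_{s (n-1)}`. -/
noncomputable def pauliString {n : ℕ} (s : Fin n → Fin 4) : Op n :=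
  Matrix.of fun a b => ∏ k, pauli (s k) (a k) (b k)

/-- The `n`-qubit Pauli group: Pauli strings times a phase in `{1, i, -1, -i}`. -/
def pauliGroup (n : ℕ) : Set (Op n) :=
  {P | ∃ (c : ℂ) (s : Fin n → Fin 4), c ^ 4 = 1 ∧ P = c • pauliString s}

/-- Clifford unitaries: unitaries that map the (finite) Pauli group into itself, hence onto itself,
by conjugation. -/
def IsClifford {n : ℕ} (U : Op n) : Prop :=
  U ∈ Matrix.unitaryGroup (Bits n) ℂ ∧ ∀ P ∈ pauliGroup n, U * P * U.conjTranspose ∈ pauliGroup n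

/-- The state vector `|0 ⋯ 0⟩`. -/
def zeroKet (n : ℕ) : Bits n → ℂ := Pi.single 0 1

/-- Stabilizer pure states: images of `|0 ⋯ 0⟩⟨0 ⋯ 0|` under Clifford unitaries. -/
def IsStabilizerPure {n : ℕ} (ψ : Op n) : Prop :=
  ∃ U : Op n, IsClifford U ∧ ψ = U * ketbra (zeroKet n) * U.conjTranspose

/-- Stabilizer states: mixtures (convex combinations) of stabilizer pure states. -/
def stabilizerStates (n : ℕ) : Set (Op n) := convexHull ℝ {ψ : Op n | IsStabilizerPure ψ}

/-- A magic state is a quantum state that is not a mixture of stabilizer pure states. -/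
def IsMagic {n : ℕ} (ρ : Op n) : Prop := IsState ρ ∧ ρ ∉ stabilizerStates n

/-- `ρ` is detected by the triangle criterion: there are three pairwise neighbouring stabilizer
pure states violating the fidelity triangle inequality. (All traces are real for states `ρ`.) -/
def TriangleDetects {n : ℕ} (ρ : Op n) : Prop :=
  ∃ ψ₁ ψ₂ ψ₃ : Op n, IsStabilizerPure ψ₁ ∧ IsStabilizerPure ψ₂ ∧ IsStabilizerPure ψ₃ ∧
    (ψ₁ * ψ₂).trace = 1 / 2 ∧ (ψ₁ * ψ₃).trace = 1 / 2 ∧ (ψ₂ * ψ₃).trace = 1 / 2 ∧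
    (ρ * ψ₁).trace.re > (ρ * ψ₂).trace.re + (ρ * ψ₃).trace.re

end Qubit

namespace Qubit

/-! Everything reduces to the neighbours of |0⟩. A Clifford conjugation moves any stabilizer pure
state to |0⟩. Nonzero amplitudes of a stabilizer vector agree up to powers of i
(`IsClifford.ket_apply`), so the stabilizer states with overlap 1/2 with |0⟩ are exactly |0⟩ + c|x⟩
with x ≠ 0 and c⁴ = 1. Two of these overlap in 1/2 only if they share x and their phases differ by
±i.

Soundness: the triangle inequality is linear in the state, so it suffices to check it on stabilizer
pure states. There it involves only the amplitudes at 0 and x, which leaves finitely many ratios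
(`triangle_amplitudes`).

Completeness for pure states: if w is undetected and w 0, w x are nonzero, the triangle inequalities
force some |0⟩ + c|x⟩ to have at least 3/2 times the fidelity of |0⟩ (`exists_fidelity_increase`).
Rotating that state to |0⟩ and repeating drives the fidelity above 1, unless w is itself a
stabilizer state.

Completeness for one qubit: stabilizer mixtures fill the Bloch octahedron |x| + |y| + |z| ≤ 1, and
beyond a face three suitably signed vertices violate the inequality. -/

open Matrix

/-! ### Pauli strings and the Pauli group -/

/-- The tensor product of a family of single-qubit operators. -/
def tensor {n : ℕ} (M : Fin n → Matrix (Fin 2) (Fin 2) ℂ) : Op n :=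
  Matrix.of fun a b => ∏ k, M k (a k) (b k)

lemma pauliString_eq_tensor {n : ℕ} (s : Fin n → Fin 4) :
    pauliString s = tensor fun k => pauli (s k) := rfl

lemma tensor_mul {n : ℕ} (M N : Fin n → Matrix (Fin 2) (Fin 2) ℂ) :
    tensor M * tensor N = tensor fun k => M k * N k := by
  ext a b
  simp only [tensor, Matrix.mul_apply, Matrix.of_apply]
  rw [Finset.prod_univ_sum]
  simp [Finset.prod_mul_distrib]

lemma tensor_smul {n : ℕ} (c : Fin n → ℂ) (M : Fin n → Matrix (Fin 2) (Fin 2) ℂ) :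
    (tensor fun k => c k • M k) = (∏ k, c k) • tensor M := by
  ext a b
  simp [tensor, Finset.prod_mul_distrib]

lemma tensor_one {n : ℕ} : (tensor fun _ : Fin n => 1) = 1 := by
  ext a b
  simp only [tensor, Matrix.of_apply, Matrix.one_apply, Finset.prod_ite_zero, funext_iff]
  simp

lemma tensor_conjTranspose {n : ℕ} (M : Fin n → Matrix (Fin 2) (Fin 2) ℂ) :
    (tensor M)ᴴ = tensor fun k => (M k)ᴴ := by
  ext a b
  simp [tensor, Matrix.conjTranspose_apply]

lemma pauli_conjTranspose (a : Fin 4) : (pauli a)ᴴ = pauli a := by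
  fin_cases a <;> ext i j <;> fin_cases i <;> fin_cases j <;>
    simp [pauli, Matrix.conjTranspose_apply]

lemma pauli_mul_self (a : Fin 4) : pauli a * pauli a = 1 := by
  fin_cases a <;> ext i j <;> fin_cases i <;> fin_cases j <;>
    simp [pauli, Matrix.mul_apply]

lemma exists_pauli_mul (a b : Fin 4) :
    ∃ (c : ℂ) (d : Fin 4), c ^ 4 = 1 ∧ pauli a * pauli b = c • pauli d := by
  have hI : (-Complex.I) ^ 4 = 1 := by rw [neg_pow, Complex.I_pow_four]; norm_num
  fin_cases a <;> fin_cases b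
  on_goal 1 => refine ⟨1, 0, by norm_num, ?_⟩
  on_goal 2 => refine ⟨1, 1, by norm_num, ?_⟩
  on_goal 3 => refine ⟨1, 2, by norm_num, ?_⟩
  on_goal 4 => refine ⟨1, 3, by norm_num, ?_⟩
  on_goal 5 => refine ⟨1, 1, by norm_num, ?_⟩
  on_goal 6 => refine ⟨1, 0, by norm_num, ?_⟩
  on_goal 7 => refine ⟨Complex.I, 3, Complex.I_pow_four, ?_⟩
  on_goal 8 => refine ⟨-Complex.I, 2, hI, ?_⟩
  on_goal 9 => refine ⟨1, 2, by norm_num, ?_⟩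
  on_goal 10 => refine ⟨-Complex.I, 3, hI, ?_⟩
  on_goal 11 => refine ⟨1, 0, by norm_num, ?_⟩
  on_goal 12 => refine ⟨Complex.I, 1, Complex.I_pow_four, ?_⟩
  on_goal 13 => refine ⟨1, 3, by norm_num, ?_⟩
  on_goal 14 => refine ⟨Complex.I, 2, Complex.I_pow_four, ?_⟩
  on_goal 15 => refine ⟨-Complex.I, 1, hI, ?_⟩
  on_goal 16 => refine ⟨1, 0, by norm_num, ?_⟩
  all_goals
    ext i j
    fin_cases i <;> fin_cases j <;> simp [pauli, Matrix.mul_apply]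

lemma exists_pauli_comm (a b : Fin 4) :
    ∃ e : ℤˣ, pauli a * pauli b = ((e : ℤ) : ℂ) • (pauli b * pauli a) := by
  by_cases h : pauli a * pauli b = pauli b * pauli a
  · exact ⟨1, by simpa using h⟩
  · refine ⟨-1, ?_⟩
    revert h
    fin_cases a <;> fin_cases b <;> intro h <;> first
      | (ext i j
         fin_cases i <;> fin_cases j <;> simp [pauli, Matrix.mul_apply]
         done)
      | exact absurd (by simp [pauli]) h

lemma pauliString_mem {n : ℕ} (s : Fin n → Fin 4) : pauliString s ∈ pauliGroup n :=
  ⟨1, s, by norm_num, by simp⟩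

lemma smul_mem_pauliGroup {n : ℕ} {c : ℂ} (hc : c ^ 4 = 1) {P : Op n} (hP : P ∈ pauliGroup n) :
    c • P ∈ pauliGroup n := by
  obtain ⟨d, s, hd, rfl⟩ := hP
  exact ⟨c * d, s, by rw [mul_pow, hc, hd, one_mul], by rw [smul_smul]⟩

lemma mul_mem_pauliGroup {n : ℕ} {P Q : Op n} (hP : P ∈ pauliGroup n) (hQ : Q ∈ pauliGroup n) :
    P * Q ∈ pauliGroup n := by
  obtain ⟨c, s, hc, rfl⟩ := hP
  obtain ⟨d, t, hd, rfl⟩ := hQ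
  choose f g hf hg using exists_pauli_mul
  rw [smul_mul_assoc, mul_smul_comm]
  refine smul_mem_pauliGroup hc (smul_mem_pauliGroup hd ?_)
  refine ⟨∏ k, f (s k) (t k), fun k => g (s k) (t k), ?_, ?_⟩
  · rw [← Finset.prod_pow]
    exact Finset.prod_eq_one fun k _ => hf _ _
  · simp only [pauliString_eq_tensor, tensor_mul, hg, tensor_smul]

lemma pauliString_conjTranspose {n : ℕ} (s : Fin n → Fin 4) :
    (pauliString s)ᴴ = pauliString s := by
  simp only [pauliString_eq_tensor, tensor_conjTranspose, pauli_conjTranspose]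

lemma pauliString_mul_self {n : ℕ} (s : Fin n → Fin 4) :
    pauliString s * pauliString s = 1 := by
  simp only [pauliString_eq_tensor, tensor_mul, pauli_mul_self, tensor_one]

lemma pauliGroup_comm {n : ℕ} {P Q : Op n} (hP : P ∈ pauliGroup n) (hQ : Q ∈ pauliGroup n) :
    P * Q = Q * P ∨ P * Q = -(Q * P) := by
  obtain ⟨c, s, hc, rfl⟩ := hP
  obtain ⟨d, t, hd, rfl⟩ := hQ
  choose e he using exists_pauli_comm
  have key : pauliString s * pauliString t =
      (((∏ k, e (s k) (t k) : ℤˣ) : ℤ) : ℂ) • (pauliString t * pauliString s) := by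
    simp only [pauliString_eq_tensor, tensor_mul]
    rw [funext fun k => he (s k) (t k), tensor_smul]
    push_cast
    rfl
  rw [smul_mul_smul_comm, smul_mul_smul_comm, key, mul_comm d c]
  rcases Int.units_eq_one_or (∏ k, e (s k) (t k)) with h | h <;> simp [h]

lemma finite_pauliGroup (n : ℕ) : (pauliGroup n).Finite := by
  have h4 : {c : ℂ | c ^ 4 = 1}.Finite := by
    refine (Polynomial.nthRootsFinset 4 (1 : ℂ)).finite_toSet.subset fun c hc => ?_
    simpa [Polynomial.mem_nthRootsFinset] using hc
  refine ((h4.prod (Set.finite_univ (α := Fin n → Fin 4))).image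
    fun p => p.1 • pauliString p.2).subset ?_
  rintro P ⟨c, s, hc, rfl⟩
  exact ⟨(c, s), ⟨hc, Set.mem_univ _⟩, rfl⟩

/-! ### Clifford unitaries and Pauli rotations -/

lemma IsClifford.mul {n : ℕ} {U V : Op n} (hU : IsClifford U) (hV : IsClifford V) :
    IsClifford (U * V) := by
  refine ⟨mul_mem hU.1 hV.1, fun P hP => ?_⟩
  have := hU.2 _ (hV.2 P hP)
  simpa [Matrix.conjTranspose_mul, mul_assoc] using this

lemma IsClifford.conjTranspose_mul_self {n : ℕ} {U : Op n} (hU : IsClifford U) : Uᴴ * U = 1 :=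
  Matrix.mem_unitaryGroup_iff'.1 hU.1

lemma IsClifford.mul_conjTranspose_self {n : ℕ} {U : Op n} (hU : IsClifford U) : U * Uᴴ = 1 :=
  Matrix.mem_unitaryGroup_iff.1 hU.1

/-- Conjugation by `U` is injective on the finite Pauli group, hence surjective onto it, so its
inverse also preserves the group. -/
lemma IsClifford.conjTranspose {n : ℕ} {U : Op n} (hU : IsClifford U) : IsClifford Uᴴ := by
  have h1 := hU.conjTranspose_mul_self
  refine ⟨Unitary.star_mem hU.1, fun P hP => ?_⟩
  have hinv : ∀ Q : Op n, Uᴴ * (U * Q * Uᴴ) * U = Q := fun Q => by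
    calc Uᴴ * (U * Q * Uᴴ) * U = (Uᴴ * U) * Q * (Uᴴ * U) := by simp only [mul_assoc]
      _ = Q := by simp [h1]
  have hsub : (fun Q => U * Q * Uᴴ) '' pauliGroup n ⊆ pauliGroup n := by
    rintro _ ⟨Q, hQ, rfl⟩
    exact hU.2 Q hQ
  have hinj : Function.Injective fun Q : Op n => U * Q * Uᴴ := fun Q R h => by
    rw [← hinv Q, ← hinv R]
    exact congrArg (fun T => Uᴴ * T * U) h
  have himg := Set.eq_of_subset_of_ncard_le hsub
    (Set.ncard_image_of_injective _ hinj).ge (finite_pauliGroup n)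
  rw [← himg] at hP
  obtain ⟨Q, hQ, rfl⟩ := hP
  rw [Matrix.conjTranspose_conjTranspose, hinv]
  exact hQ

lemma isClifford_one {n : ℕ} : IsClifford (1 : Op n) :=
  ⟨one_mem _, fun P hP => by simpa using hP⟩

/-- The Clifford rotation `exp(i π P / 4) = (1 + i P) / √2` generated by a Hermitian Pauli. -/
noncomputable def pauliRotation {n : ℕ} (P : Op n) : Op n :=
  ((√2 : ℝ) : ℂ)⁻¹ • (1 + Complex.I • P)

lemma inv_sqrt_two_mul_self : ((√2 : ℝ) : ℂ)⁻¹ * ((√2 : ℝ) : ℂ)⁻¹ = 1 / 2 := by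
  rw [← mul_inv, ← Complex.ofReal_mul, Real.mul_self_sqrt (by norm_num)]
  norm_num

/-- Any Pauli Q commutes or anticommutes with P: in the first case the rotation fixes Q, in the
second it sends Q to -i QP. -/
lemma isClifford_pauliRotation {n : ℕ} {P : Op n} (hP : P ∈ pauliGroup n) (hH : Pᴴ = P)
    (h2 : P * P = 1) : IsClifford (pauliRotation P) := by
  have hI : Complex.I * Complex.I = -1 := Complex.I_mul_I
  have hstar : (pauliRotation P)ᴴ = ((√2 : ℝ) : ℂ)⁻¹ • (1 - Complex.I • P) := by
    simp [pauliRotation, Matrix.conjTranspose_smul, hH, sub_eq_add_neg]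
  refine ⟨Matrix.mem_unitaryGroup_iff.2 ?_, fun Q hQ => ?_⟩
  · rw [Matrix.star_eq_conjTranspose, hstar, pauliRotation, smul_mul_smul_comm,
      inv_sqrt_two_mul_self]
    simp only [add_mul, mul_sub, smul_mul_smul_comm, h2, hI, one_mul, mul_one]
    module
  · rw [hstar, pauliRotation, smul_mul_assoc, smul_mul_smul_comm, inv_sqrt_two_mul_self]
    rcases pauliGroup_comm hP hQ with h | h
    · have : (1 + Complex.I • P) * Q * (1 - Complex.I • P) = (2 : ℂ) • Q := by
        simp only [add_mul, mul_sub, smul_mul_assoc, mul_smul_comm, one_mul, mul_one, h,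
          mul_assoc, h2]
        match_scalars <;> first | ring1 | linear_combination -hI
      rw [this, smul_smul]
      simpa using hQ
    · have : (1 + Complex.I • P) * Q * (1 - Complex.I • P) =
          (2 : ℂ) • ((-Complex.I) • (Q * P)) := by
        simp only [add_mul, mul_sub, smul_mul_assoc, mul_smul_comm, one_mul, mul_one, h,
          neg_mul, smul_neg, mul_assoc, h2]
        match_scalars <;> first | ring1 | linear_combination hI
      rw [this, smul_smul]
      norm_num only [one_smul]
      exact smul_mem_pauliGroup (by rw [neg_pow, Complex.I_pow_four]; norm_num)
        (mul_mem_pauliGroup hQ hP)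

/-! ### Rank-one projectors and overlaps -/

lemma conj_ketbra {n : ℕ} (U : Op n) (v : Bits n → ℂ) :
    U * ketbra v * Uᴴ = ketbra (U *ᵥ v) := by
  rw [ketbra, ketbra, Matrix.mul_vecMulVec, Matrix.vecMulVec_mul, Matrix.star_mulVec]

lemma trace_mul_ketbra {n : ℕ} (ρ : Op n) (u : Bits n → ℂ) :
    (ρ * ketbra u).trace = star u ⬝ᵥ (ρ *ᵥ u) := by
  rw [ketbra, Matrix.mul_vecMulVec, Matrix.trace_vecMulVec, dotProduct_comm]

lemma trace_ketbra_mul_ketbra {n : ℕ} (w u : Bits n → ℂ) :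
    (ketbra w * ketbra u).trace = ((‖star u ⬝ᵥ w‖ ^ 2 : ℝ) : ℂ) := by
  rw [trace_mul_ketbra, ketbra, Matrix.vecMulVec_mulVec, Complex.ofReal_pow, ← Complex.mul_conj']
  rw [dotProduct_smul, op_smul_eq_smul, smul_eq_mul, mul_comm, starRingEnd_apply, ← Matrix.star_dotProduct_star, star_star]

lemma trace_conj {n : ℕ} {U : Op n} (hU : Uᴴ * U = 1) (A B : Op n) :
    ((U * A * Uᴴ) * (U * B * Uᴴ)).trace = (A * B).trace := by
  have : (U * A * Uᴴ) * (U * B * Uᴴ) = U * (A * B) * Uᴴ := by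
    calc _ = U * A * (Uᴴ * U) * B * Uᴴ := by simp only [mul_assoc]
      _ = _ := by rw [hU, mul_one, mul_assoc U]
  rw [this, Matrix.trace_mul_comm, ← mul_assoc, hU, one_mul]

lemma isStabilizerPure_iff {n : ℕ} {ψ : Op n} :
    IsStabilizerPure ψ ↔ ∃ U : Op n, IsClifford U ∧ ψ = ketbra (U *ᵥ zeroKet n) := by
  simp only [IsStabilizerPure, conj_ketbra]

lemma IsStabilizerPure.conj {n : ℕ} {U ψ : Op n} (hU : IsClifford U) (h : IsStabilizerPure ψ) :
    IsStabilizerPure (U * ψ * Uᴴ) := by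
  obtain ⟨V, hV, rfl⟩ := h
  refine ⟨U * V, hU.mul hV, ?_⟩
  simp only [Matrix.conjTranspose_mul, mul_assoc]

lemma sum_norm_sq_mulVec {n : ℕ} {U : Op n} (hU : Uᴴ * U = 1) (v : Bits n → ℂ) :
    ∑ b, ‖(U *ᵥ v) b‖ ^ 2 = ∑ b, ‖v b‖ ^ 2 := by
  have h : ∀ w : Bits n → ℂ, ((∑ b, ‖w b‖ ^ 2 : ℝ) : ℂ) = star w ⬝ᵥ w := fun w => by
    simp only [dotProduct, Pi.star_apply, Complex.ofReal_sum, Complex.ofReal_pow]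
    exact Finset.sum_congr rfl fun b _ => by rw [← Complex.conj_mul']; rfl
  apply Complex.ofReal_injective
  rw [h, h, Matrix.star_mulVec, Matrix.dotProduct_mulVec, Matrix.vecMul_vecMul, hU,
    Matrix.vecMul_one]

lemma sum_norm_sq_zeroKet (n : ℕ) : ∑ b, ‖zeroKet n b‖ ^ 2 = 1 := by
  rw [Finset.sum_eq_single 0]
  · simp [zeroKet]
  · intro b _ hb
    simp [zeroKet, hb]
  · simp

/-! ### Amplitudes of stabilizer vectors -/

/-- Each row of a Pauli string has a single nonzero entry, which is a fourth root of unity. -/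
lemma pauliGroup_row {n : ℕ} {P : Op n} (hP : P ∈ pauliGroup n) (a : Bits n) :
    ∃ (b : Bits n) (c : ℂ), c ^ 4 = 1 ∧ P a = Pi.single b c := by
  have hI : (-Complex.I) ^ 4 = 1 := by rw [neg_pow, Complex.I_pow_four]; norm_num
  have h1 : ∀ (p : Fin 4) (i : Fin 2), ∃ (j : Fin 2) (c : ℂ), c ^ 4 = 1 ∧
      ∀ k, pauli p i k = if k = j then c else 0 := by
    intro p i
    fin_cases p <;> fin_cases i
    on_goal 1 => refine ⟨0, 1, by norm_num, ?_⟩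
    on_goal 2 => refine ⟨1, 1, by norm_num, ?_⟩
    on_goal 3 => refine ⟨1, 1, by norm_num, ?_⟩
    on_goal 4 => refine ⟨0, 1, by norm_num, ?_⟩
    on_goal 5 => refine ⟨1, -Complex.I, hI, ?_⟩
    on_goal 6 => refine ⟨0, Complex.I, Complex.I_pow_four, ?_⟩
    on_goal 7 => refine ⟨0, 1, by norm_num, ?_⟩
    on_goal 8 => refine ⟨1, -1, by norm_num, ?_⟩
    all_goals
      intro k
      fin_cases k <;> simp [pauli]
  choose f g hg hf using h1
  obtain ⟨c, s, hc, rfl⟩ := hP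
  refine ⟨fun k => f (s k) (a k), c * ∏ k, g (s k) (a k), ?_, ?_⟩
  · rw [mul_pow, hc, one_mul, ← Finset.prod_pow]
    exact Finset.prod_eq_one fun k _ => hg _ _
  · ext b
    simp only [Matrix.smul_apply, pauliString, Matrix.of_apply, hf, Finset.prod_ite_zero,
      Finset.mem_univ, true_implies, Pi.single_apply, funext_iff, smul_eq_mul, mul_ite, mul_zero]

lemma mulVec_zeroKet_apply {n : ℕ} (U : Op n) (b : Bits n) : (U *ᵥ zeroKet n) b = U b 0 := by
  simp [zeroKet]

lemma pauliString_mulVec_zeroKet {n : ℕ} {s : Fin n → Fin 4} {x : Bits n} {g : Fin n → ℂ}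
    (h : ∀ k i, pauli (s k) i 0 = if i = x k then g k else 0) :
    pauliString s *ᵥ zeroKet n = Pi.single x (∏ k, g k) := by
  ext b
  rw [mulVec_zeroKet_apply]
  simp only [pauliString, Matrix.of_apply, Pi.zero_apply, h, Finset.prod_ite_zero,
    Finset.mem_univ, true_implies, Pi.single_apply, funext_iff]

/-- The label of the Pauli string `Z^z`. -/
def zLabel {n : ℕ} (z : Bits n) : Fin n → Fin 4 := fun k => if z k = 0 then 0 else 3

lemma pauliString_zLabel_mulVec_zeroKet {n : ℕ} (z : Bits n) :
    pauliString (zLabel z) *ᵥ zeroKet n = zeroKet n := by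
  rw [pauliString_mulVec_zeroKet (x := 0) (g := fun _ => 1)]
  · simp [zeroKet]
  · intro k i
    rcases eq_or_ne (z k) 0 with h | h <;> fin_cases i <;> simp [zLabel, h, pauli]

/-- The sum factors over the qubits, and I + Z = 2|0⟩⟨0| on each. This writes the projector onto |0⟩
as the average of its stabilizer group. -/
lemma sum_pauliString_zLabel (n : ℕ) :
    ∑ z : Bits n, pauliString (zLabel z) = (2 : ℂ) ^ n • ketbra (zeroKet n) := by
  ext a b
  have h : ∀ i j : Fin 2, ∑ l : Fin 2, pauli (if l = 0 then 0 else 3) i j =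
      if i = 0 ∧ j = 0 then 2 else 0 := by
    intro i j
    fin_cases i <;> fin_cases j <;> simp [pauli]; norm_num
  have hl : (∑ z : Bits n, pauliString (zLabel z)) a b =
      ∏ k, ∑ l : Fin 2, pauli (if l = 0 then 0 else 3) (a k) (b k) := by
    rw [Finset.prod_univ_sum, Matrix.sum_apply]
    simp [pauliString, zLabel]
  rw [hl]
  simp only [h, Finset.prod_ite_zero, Finset.mem_univ, true_implies, Finset.prod_const,
    Finset.card_univ, Fintype.card_fin, ketbra, zeroKet, Matrix.smul_apply,
    Matrix.vecMulVec_apply, Pi.single_apply, Pi.star_apply, smul_eq_mul, forall_and]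
  have hz : ∀ b : Bits n, (∀ k, b k = 0) ↔ b = 0 := fun b => funext_iff.symm
  simp only [hz]
  by_cases ha : a = 0 <;> by_cases hb : b = 0 <;> simp [ha, hb]

/-- Nonzero amplitudes of a stabilizer state differ from the first one by powers of `i`. -/
lemma IsClifford.ket_apply {n : ℕ} {U : Op n} (hU : IsClifford U) (x : Bits n)
    (h0 : (U *ᵥ zeroKet n) 0 ≠ 0) (hx : (U *ᵥ zeroKet n) x ≠ 0) :
    ∃ c : ℂ, c ^ 4 = 1 ∧ (U *ᵥ zeroKet n) x = c * (U *ᵥ zeroKet n) 0 := by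
  set φ := U *ᵥ zeroKet n with hφ
  have hsum : ∑ z : Bits n, U * pauliString (zLabel z) * Uᴴ = (2 : ℂ) ^ n • ketbra φ := by
    rw [← Finset.sum_mul, ← Finset.mul_sum, sum_pauliString_zLabel, mul_smul_comm, smul_mul_assoc,
      conj_ketbra]
  -- Some stabilizer element of φ must have a nonzero (x, 0) entry. As it has one entry per row and
  -- fixes φ, that entry is the ratio of φ x to φ 0.
  have hne : (∑ z : Bits n, U * pauliString (zLabel z) * Uᴴ) x 0 ≠ 0 := by
    rw [hsum]
    simp [ketbra, Matrix.vecMulVec_apply, h0, hx]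
  rw [Matrix.sum_apply] at hne
  obtain ⟨z, -, hz⟩ := Finset.exists_ne_zero_of_sum_ne_zero hne
  obtain ⟨b, c, hc, hrow⟩ := pauliGroup_row (hU.2 _ (pauliString_mem (zLabel z))) x
  have hb : b = 0 := by
    by_contra hb
    rw [hrow, Pi.single_eq_of_ne (Ne.symm hb)] at hz
    exact hz rfl
  subst hb
  refine ⟨c, hc, ?_⟩
  have hstab : (U * pauliString (zLabel z) * Uᴴ) *ᵥ φ = φ := by
    rw [hφ, Matrix.mulVec_mulVec, mul_assoc, mul_assoc, hU.conjTranspose_mul_self, mul_one,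
      ← Matrix.mulVec_mulVec, pauliString_zLabel_mulVec_zeroKet]
  calc φ x = ((U * pauliString (zLabel z) * Uᴴ) *ᵥ φ) x := by rw [hstab]
    _ = c * φ 0 := by rw [Matrix.mulVec, hrow, single_dotProduct]

lemma fourth_root_cases {c : ℂ} (hc : c ^ 4 = 1) :
    c = 1 ∨ c = -1 ∨ c = Complex.I ∨ c = -Complex.I := by
  have h : (c - 1) * ((c + 1) * ((c - Complex.I) * (c + Complex.I))) = 0 := by
    linear_combination hc - (c ^ 2 - 1) * Complex.I_sq
  rcases mul_eq_zero.1 h with h | h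
  · exact Or.inl (sub_eq_zero.1 h)
  rcases mul_eq_zero.1 h with h | h
  · exact Or.inr (Or.inl (eq_neg_of_add_eq_zero_left h))
  rcases mul_eq_zero.1 h with h | h
  · exact Or.inr (Or.inr (Or.inl (sub_eq_zero.1 h)))
  · exact Or.inr (Or.inr (Or.inr (eq_neg_of_add_eq_zero_left h)))

/-! ### Clifford preparation of |x⟩ and |0⟩ + c|x⟩ -/

lemma exists_hermitian_pauli {n : ℕ} {x : Bits n} (hx : x ≠ 0) {d : ℂ} (hd : d ^ 4 = 1) :
    ∃ P ∈ pauliGroup n, Pᴴ = P ∧ P * P = 1 ∧ P *ᵥ zeroKet n = Pi.single x d := by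
  obtain ⟨k₀, hk₀⟩ := Function.ne_iff.1 hx
  have hX : pauliString (fun k => if x k = 0 then 0 else 1) *ᵥ zeroKet n = Pi.single x 1 := by
    rw [pauliString_mulVec_zeroKet (x := x) (g := fun _ => 1)]
    · simp
    · intro k i
      generalize x k = y
      fin_cases y <;> fin_cases i <;> simp [pauli]
  -- Replacing a single X by Y at a site where x is nonzero contributes the factor i.
  have hY : pauliString (fun k => if x k = 0 then 0 else if k = k₀ then 2 else 1) *ᵥ zeroKet n =
      Pi.single x Complex.I := by
    rw [pauliString_mulVec_zeroKet (x := x) (g := fun k => if k = k₀ then Complex.I else 1)]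
    · simp
    · intro k i
      by_cases hk : k = k₀
      · subst hk
        have : x k = 1 := Fin.eq_one_of_ne_zero _ hk₀
        fin_cases i <;> simp [pauli, this]
      · generalize x k = y
        fin_cases y <;> fin_cases i <;> simp [pauli, hk]
  have hneg : ∀ s : Fin n → Fin 4, ∀ e : ℂ, pauliString s *ᵥ zeroKet n = Pi.single x e →
      ∃ P ∈ pauliGroup n, Pᴴ = P ∧ P * P = 1 ∧ P *ᵥ zeroKet n = Pi.single x (-e) := by
    intro s e h
    refine ⟨(-1 : ℂ) • pauliString s, smul_mem_pauliGroup (by norm_num) (pauliString_mem s),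
      ?_, ?_, ?_⟩
    · simp [pauliString_conjTranspose]
    · simp [pauliString_mul_self]
    · rw [Matrix.smul_mulVec, h, Pi.single_neg, neg_one_smul]
  rcases fourth_root_cases hd with rfl | rfl | rfl | rfl
  · exact ⟨_, pauliString_mem _, pauliString_conjTranspose _, pauliString_mul_self _, hX⟩
  · exact hneg _ _ hX
  · exact ⟨_, pauliString_mem _, pauliString_conjTranspose _, pauliString_mul_self _, hY⟩
  · exact hneg _ _ hY

/-- The unnormalized vector `|0⟩ + c |x⟩`. -/
def pairKet {n : ℕ} (x : Bits n) (c : ℂ) : Bits n → ℂ := zeroKet n + Pi.single x c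

lemma exists_clifford_pairKet {n : ℕ} {x : Bits n} (hx : x ≠ 0) {c : ℂ} (hc : c ^ 4 = 1) :
    ∃ U : Op n, IsClifford U ∧ U *ᵥ zeroKet n = ((√2 : ℝ) : ℂ)⁻¹ • pairKet x c := by
  -- The phase -ic cancels the i of the rotation: iP|0⟩ = c|x⟩.
  have hd : (-Complex.I * c) ^ 4 = 1 := by
    rw [mul_pow, neg_pow, Complex.I_pow_four, hc]; norm_num
  obtain ⟨P, hP, hH, h2, h0⟩ := exists_hermitian_pauli hx hd
  refine ⟨pauliRotation P, isClifford_pauliRotation hP hH h2, ?_⟩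
  rw [pauliRotation, Matrix.smul_mulVec, Matrix.add_mulVec, Matrix.one_mulVec,
    Matrix.smul_mulVec, h0, pairKet, ← Pi.single_smul, smul_eq_mul, ← mul_assoc, mul_neg,
    Complex.I_mul_I, neg_neg, one_mul]

lemma exists_clifford_basisKet {n : ℕ} (x : Bits n) :
    ∃ U : Op n, IsClifford U ∧ U *ᵥ zeroKet n = Pi.single x 1 := by
  rcases eq_or_ne x 0 with rfl | hx
  · exact ⟨1, isClifford_one, by rw [Matrix.one_mulVec, zeroKet]⟩
  · obtain ⟨P, hP, hH, h2, h0⟩ := exists_hermitian_pauli hx (d := 1) (by norm_num)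
    refine ⟨P, ⟨Matrix.mem_unitaryGroup_iff.2 ?_, fun Q hQ => ?_⟩, h0⟩
    · rw [Matrix.star_eq_conjTranspose, hH, h2]
    · rw [hH]
      exact mul_mem_pauliGroup (mul_mem_pauliGroup hP hQ) hP

lemma isStabilizerPure_basisKet {n : ℕ} (x : Bits n) :
    IsStabilizerPure (ketbra (Pi.single x 1)) := by
  obtain ⟨U, hU, h⟩ := exists_clifford_basisKet x
  exact isStabilizerPure_iff.2 ⟨U, hU, by rw [h]⟩

lemma isStabilizerPure_pairKet {n : ℕ} {x : Bits n} (hx : x ≠ 0) {c : ℂ} (hc : c ^ 4 = 1) :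
    IsStabilizerPure (ketbra (((√2 : ℝ) : ℂ)⁻¹ • pairKet x c)) := by
  obtain ⟨U, hU, h⟩ := exists_clifford_pairKet hx hc
  exact isStabilizerPure_iff.2 ⟨U, hU, by rw [h]⟩

/-! ### The neighbours of |0⟩ -/

open ComplexConjugate

/-- The stabilizer state proportional to `|0⟩ + c |x⟩`, for `x ≠ 0` and `c ^ 4 = 1`. -/
noncomputable def pairState {n : ℕ} (x : Bits n) (c : ℂ) : Op n :=
  ketbra (((√2 : ℝ) : ℂ)⁻¹ • pairKet x c)

lemma norm_inv_sqrt_two_sq : ‖((√2 : ℝ) : ℂ)⁻¹‖ ^ 2 = 1 / 2 := by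
  rw [norm_inv, Complex.norm_real, Real.norm_eq_abs, inv_pow, sq_abs,
    Real.sq_sqrt (by norm_num)]
  norm_num

lemma norm_eq_one_of_fourth_root {c : ℂ} (hc : c ^ 4 = 1) : ‖c‖ = 1 := by
  rcases fourth_root_cases hc with rfl | rfl | rfl | rfl <;> simp

lemma ketbra_smul {n : ℕ} (s : ℂ) (v : Bits n → ℂ) :
    ketbra (s • v) = ((‖s‖ ^ 2 : ℝ) : ℂ) • ketbra v := by
  ext a b
  simp only [ketbra, Matrix.vecMulVec_apply, Pi.smul_apply, smul_eq_mul, Pi.star_apply,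
    star_mul', Matrix.smul_apply, Complex.ofReal_pow, ← Complex.mul_conj', starRingEnd_apply]
  ring

lemma star_zeroKet_dotProduct {n : ℕ} (w : Bits n → ℂ) : star (zeroKet n) ⬝ᵥ w = w 0 := by
  rw [zeroKet, ← Pi.single_star, star_one, single_one_dotProduct]

lemma star_pairKet_dotProduct {n : ℕ} (x : Bits n) (c : ℂ) (w : Bits n → ℂ) :
    star (pairKet x c) ⬝ᵥ w = w 0 + conj c * w x := by
  rw [pairKet, star_add, add_dotProduct, star_zeroKet_dotProduct, ← Pi.single_star,
    single_dotProduct, starRingEnd_apply]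

lemma trace_ketbra_mul_zeroKet {n : ℕ} (w : Bits n → ℂ) :
    (ketbra w * ketbra (zeroKet n)).trace = ((‖w 0‖ ^ 2 : ℝ) : ℂ) := by
  rw [trace_ketbra_mul_ketbra, star_zeroKet_dotProduct]

lemma trace_ketbra_mul_pairState {n : ℕ} (w : Bits n → ℂ) (x : Bits n) (c : ℂ) :
    (ketbra w * pairState x c).trace = ((‖w 0 + conj c * w x‖ ^ 2 / 2 : ℝ) : ℂ) := by
  rw [pairState, trace_ketbra_mul_ketbra, star_smul, smul_dotProduct, star_pairKet_dotProduct,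
    norm_smul, mul_pow, norm_star, norm_inv_sqrt_two_sq, one_div_mul_eq_div]

lemma pairKet_zero {n : ℕ} {x : Bits n} (hx : x ≠ 0) (c : ℂ) : pairKet x c 0 = 1 := by
  simp [pairKet, zeroKet, Pi.single_eq_of_ne hx.symm]

lemma pairKet_self {n : ℕ} {x : Bits n} (hx : x ≠ 0) (c : ℂ) : pairKet x c x = c := by
  simp [pairKet, zeroKet, Pi.single_eq_of_ne hx]

lemma pairKet_of_ne {n : ℕ} {x y : Bits n} (hy : y ≠ 0) (hxy : y ≠ x) (c : ℂ) :
    pairKet x c y = 0 := by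
  simp [pairKet, zeroKet, Pi.single_eq_of_ne hy, Pi.single_eq_of_ne hxy]

lemma trace_zeroKet_mul_pairState {n : ℕ} {x : Bits n} (hx : x ≠ 0) (c : ℂ) :
    (ketbra (zeroKet n) * pairState x c).trace = 1 / 2 := by
  rw [trace_ketbra_mul_pairState]
  simp [zeroKet, Pi.single_eq_of_ne hx]

lemma trace_pairState_mul_pairState {n : ℕ} {x : Bits n} (hx : x ≠ 0) (y : Bits n) (c d : ℂ) :
    (pairState x c * pairState y d).trace =
      ((‖1 + conj d * pairKet x c y‖ ^ 2 / 4 : ℝ) : ℂ) := by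
  rw [pairState, trace_ketbra_mul_pairState]
  congr 1
  simp only [Pi.smul_apply, smul_eq_mul, pairKet_zero hx]
  rw [mul_left_comm, ← mul_add, norm_mul, mul_pow, norm_inv_sqrt_two_sq]
  ring

/-- The stabilizer states having overlap `1 / 2` with `|0⟩` are the states `|0⟩ + c |x⟩`. -/
lemma IsStabilizerPure.eq_pairState {n : ℕ} {ψ : Op n} (hψ : IsStabilizerPure ψ)
    (h : (ketbra (zeroKet n) * ψ).trace = 1 / 2) :
    ∃ (x : Bits n) (c : ℂ), x ≠ 0 ∧ c ^ 4 = 1 ∧ ψ = pairState x c := by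
  obtain ⟨U, hU, rfl⟩ := isStabilizerPure_iff.1 hψ
  have hnorm := (sum_norm_sq_mulVec hU.conjTranspose_mul_self (zeroKet n)).trans
    (sum_norm_sq_zeroKet n)
  have happ := hU.ket_apply
  generalize U *ᵥ zeroKet n = p at *
  rw [Matrix.trace_mul_comm, trace_ketbra_mul_zeroKet] at h
  have hp0 : ‖p 0‖ ^ 2 = 1 / 2 := by
    apply Complex.ofReal_injective
    rw [h]; norm_num
  have h0 : p 0 ≠ 0 := fun h => by rw [h] at hp0; norm_num at hp0
  -- The amplitude at 0 carries half the norm. Any other nonzero amplitude has the same modulus, so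
  -- exactly one exists and it exhausts the rest.
  rw [← Finset.add_sum_erase _ _ (Finset.mem_univ 0), hp0] at hnorm
  obtain ⟨x, hx, hpx⟩ := Finset.exists_ne_zero_of_sum_ne_zero
    (s := Finset.univ.erase (0 : Bits n)) (f := fun b => ‖p b‖ ^ 2) (by linarith)
  have hx0 : x ≠ 0 := Finset.ne_of_mem_erase hx
  have hpx0 : p x ≠ 0 := fun h => hpx (by simp [h])
  obtain ⟨c, hc, hcx⟩ := happ x h0 hpx0
  have hpx' : ‖p x‖ ^ 2 = 1 / 2 := by
    rw [hcx, norm_mul, norm_eq_one_of_fourth_root hc, one_mul, hp0]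
  rw [← Finset.add_sum_erase _ _ hx, hpx'] at hnorm
  have hrest := (Finset.sum_eq_zero_iff_of_nonneg fun b _ => by positivity).1
    (show ∑ b ∈ (Finset.univ.erase (0 : Bits n)).erase x, ‖p b‖ ^ 2 = 0 by linarith)
  refine ⟨x, c, hx0, hc, ?_⟩
  have hp : p = p 0 • pairKet x c := by
    ext b
    rw [Pi.smul_apply, smul_eq_mul]
    by_cases hb : b = 0
    · rw [hb, pairKet_zero hx0, mul_one]
    by_cases hbx : b = x
    · rw [hbx, pairKet_self hx0, hcx, mul_comm]
    · rw [pairKet_of_ne hb hbx, mul_zero]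
      simpa using hrest b (by simp [hb, hbx])
  rw [hp, pairState, ketbra_smul, ketbra_smul, norm_inv_sqrt_two_sq, hp0]

/-! ### Soundness: the triangle inequality on stabilizer states -/

/-- After factoring out ‖a‖², only the relative phases f = conj d · c and g = conj c · e matter.
Both are fourth roots of unity, so the claim is a finite check. -/
lemma triangle_amplitudes {a b c d : ℂ} (hc : c ^ 4 = 1) (hd : d ^ 4 = 1)
    (hcd : ‖1 + conj d * c‖ ^ 2 = 2) (hb : b ≠ 0 → ∃ e : ℂ, e ^ 4 = 1 ∧ b = e * a) :
    ‖a‖ ^ 2 ≤ ‖a + conj c * b‖ ^ 2 / 2 + ‖a + conj d * b‖ ^ 2 / 2 := by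
  by_cases hb0 : b = 0
  · simp [hb0]
  obtain ⟨e, he, rfl⟩ := hb hb0
  have hconj : ∀ {z : ℂ}, z ^ 4 = 1 → (conj z) ^ 4 = 1 := fun h => by
    rw [← map_pow, h, map_one]
  have hcc : conj c * c = 1 := by
    rw [Complex.conj_mul', norm_eq_one_of_fourth_root hc]; norm_num
  have hu : conj d * e = (conj d * c) * (conj c * e) := by
    linear_combination (-conj d * e) * hcc
  have h1 : ‖a + conj c * (e * a)‖ ^ 2 = ‖1 + conj c * e‖ ^ 2 * ‖a‖ ^ 2 := by
    rw [← mul_pow, ← norm_mul]; ring_nf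
  have h2 : ‖a + conj d * (e * a)‖ ^ 2 = ‖1 + (conj d * c) * (conj c * e)‖ ^ 2 * ‖a‖ ^ 2 := by
    rw [← hu, ← mul_pow, ← norm_mul]; ring_nf
  rw [h1, h2]
  have hf : (conj d * c) ^ 4 = 1 := by rw [mul_pow, hconj hd, hc, one_mul]
  have hg : (conj c * e) ^ 4 = 1 := by rw [mul_pow, hconj hc, he, one_mul]
  generalize conj d * c = f at *
  generalize conj c * e = g at *
  have key : 2 ≤ ‖1 + g‖ ^ 2 + ‖1 + f * g‖ ^ 2 := by
    rw [Complex.sq_norm] at hcd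
    rw [Complex.sq_norm, Complex.sq_norm]
    -- The overlap hypothesis rules out f = ±1. For f = ±i, at most one of 1 + g and 1 + fg
    -- vanishes, and the other then has squared norm 2.
    rcases fourth_root_cases hf with rfl | rfl | rfl | rfl
    · norm_num [Complex.normSq_apply] at hcd
    · norm_num [Complex.normSq_apply] at hcd
    all_goals
      rcases fourth_root_cases hg with rfl | rfl | rfl | rfl <;>
        norm_num [Complex.normSq_apply]
  nlinarith [mul_le_mul_of_nonneg_right key (sq_nonneg ‖a‖)]

/-- The triangle inequality for the fidelities of a stabilizer state with three pairwise
neighbouring stabilizer states. -/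
lemma IsStabilizerPure.triangle {n : ℕ} {φ ψ₁ ψ₂ ψ₃ : Op n} (hφ : IsStabilizerPure φ)
    (h₁ : IsStabilizerPure ψ₁) (h₂ : IsStabilizerPure ψ₂) (h₃ : IsStabilizerPure ψ₃)
    (h₁₂ : (ψ₁ * ψ₂).trace = 1 / 2) (h₁₃ : (ψ₁ * ψ₃).trace = 1 / 2)
    (h₂₃ : (ψ₂ * ψ₃).trace = 1 / 2) :
    (φ * ψ₁).trace.re ≤ (φ * ψ₂).trace.re + (φ * ψ₃).trace.re := by
  obtain ⟨U, hU, rfl⟩ := isStabilizerPure_iff.1 h₁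
  have hU' := hU.conjTranspose
  have htr := trace_conj hU'.conjTranspose_mul_self
  rw [← htr] at h₁₂ h₁₃ h₂₃ ⊢
  rw [← htr φ ψ₂, ← htr φ ψ₃]
  have h₁' : Uᴴ * ketbra (U *ᵥ zeroKet n) * Uᴴᴴ = ketbra (zeroKet n) := by
    rw [conj_ketbra, Matrix.mulVec_mulVec, hU.conjTranspose_mul_self, Matrix.one_mulVec]
  rw [h₁'] at h₁₂ h₁₃ ⊢
  obtain ⟨x, c, hx, hc, h₂'⟩ := (h₂.conj hU').eq_pairState h₁₂
  obtain ⟨y, d, hy, hd, h₃'⟩ := (h₃.conj hU').eq_pairState h₁₃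
  rw [h₂', h₃', trace_pairState_mul_pairState hx] at h₂₃
  rw [h₂', h₃']
  have h₂₃' : ‖1 + conj d * pairKet x c y‖ ^ 2 / 4 = 1 / 2 := by
    apply Complex.ofReal_injective
    rw [h₂₃]; norm_num
  -- Distinct x and y would leave only the component at 0 in common, giving overlap 1/4.
  have hxy : y = x := by
    by_contra hne
    rw [pairKet_of_ne hy hne] at h₂₃'
    norm_num at h₂₃'
  subst hxy
  rw [pairKet_self hx] at h₂₃'
  obtain ⟨V, hV, hφ'⟩ := isStabilizerPure_iff.1 (hφ.conj hU')
  rw [hφ', trace_ketbra_mul_zeroKet, trace_ketbra_mul_pairState, trace_ketbra_mul_pairState,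
    Complex.ofReal_re, Complex.ofReal_re, Complex.ofReal_re]
  by_cases h0 : (V *ᵥ zeroKet n) 0 = 0
  · rw [h0, norm_zero, zero_pow two_ne_zero]
    exact add_nonneg (by positivity) (by positivity)
  · exact triangle_amplitudes hc hd (by linarith) fun hb => hV.ket_apply y h0 hb

/-- The inequality cuts out a half-space, so it passes from the stabilizer pure states to their
convex hull. -/
lemma TriangleDetects.notMem_stabilizerStates {n : ℕ} {ρ : Op n} (h : TriangleDetects ρ) :
    ρ ∉ stabilizerStates n := by
  obtain ⟨ψ₁, ψ₂, ψ₃, h₁, h₂, h₃, h₁₂, h₁₃, h₂₃, hlt⟩ := h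
  intro hρ
  have hconv : Convex ℝ {φ : Op n | (φ * ψ₁).trace.re ≤ (φ * ψ₂).trace.re + (φ * ψ₃).trace.re} := by
    intro φ hφ χ hχ a b ha hb _
    simp only [Set.mem_ofPred_eq, add_mul, smul_mul_assoc, Matrix.trace_add, Matrix.trace_smul,
      Complex.add_re, Complex.smul_re, smul_eq_mul] at *
    nlinarith [mul_le_mul_of_nonneg_left hφ ha, mul_le_mul_of_nonneg_left hχ hb]
  exact absurd (convexHull_min (fun φ hφ => hφ.triangle h₁ h₂ h₃ h₁₂ h₁₃ h₂₃) hconv hρ)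
    (not_le.2 hlt)

lemma TriangleDetects.of_conj {n : ℕ} {U ρ : Op n} (hU : IsClifford U)
    (h : TriangleDetects (U * ρ * Uᴴ)) : TriangleDetects ρ := by
  obtain ⟨ψ₁, ψ₂, ψ₃, h₁, h₂, h₃, h₁₂, h₁₃, h₂₃, hlt⟩ := h
  have hU' := hU.conjTranspose
  have htr := trace_conj hU'.conjTranspose_mul_self
  have hρ : Uᴴ * (U * ρ * Uᴴ) * Uᴴᴴ = ρ := by
    calc _ = (Uᴴ * U) * ρ * (Uᴴ * U) := by
          simp only [mul_assoc, Matrix.conjTranspose_conjTranspose]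
      _ = ρ := by simp [hU.conjTranspose_mul_self]
  refine ⟨_, _, _, h₁.conj hU', h₂.conj hU', h₃.conj hU', ?_, ?_, ?_, ?_⟩
  · rwa [htr]
  · rwa [htr]
  · rwa [htr]
  · rw [← htr, ← htr (U * ρ * Uᴴ) ψ₂, ← htr (U * ρ * Uᴴ) ψ₃, hρ] at hlt
    exact hlt

/-! ### Completeness for pure states: fidelity amplification -/

/-- If `A = |a|²`, `B = |b|²` and `r + i s = conj a * b` satisfy `|r| + |s| ≤ B`, then one of
`|r|`, `|s|` is large. -/
lemma exists_large_component {A B r s : ℝ} (hA : 0 < A) (hB : 0 < B)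
    (hid : r ^ 2 + s ^ 2 = A * B) (h : |r| + |s| ≤ B) (hr : |r| < A - B / 2) :
    A - B / 2 ≤ |s| := by
  by_contra! hs
  rw [← sq_abs r, ← sq_abs s] at hid
  have hr0 := abs_nonneg r
  have hs0 := abs_nonneg s
  generalize |r| = r' at *
  generalize |s| = s' at *
  have hAB : A ≤ B := by
    have : A * B ≤ B * B := by nlinarith [mul_nonneg hr0 hs0]
    exact le_of_mul_le_mul_right this hB
  -- Here B/2 < A ≤ B, and on this range 2(A - B/2)² < AB, contradicting r² + s² = AB.
  nlinarith [mul_le_mul hr.le hr.le hr0 (hr0.trans hr.le),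
    mul_le_mul hs.le hs.le hs0 (hs0.trans hs.le), mul_pos hA hB]

/-- If the pure state `w` is not detected, then for `w 0 ≠ 0 ≠ w x` one of the neighbouring
states `|0⟩ + c |x⟩` has substantially larger fidelity than `|0⟩`. -/
lemma exists_fidelity_increase {n : ℕ} {w : Bits n → ℂ} (hw : ¬ TriangleDetects (ketbra w))
    {x : Bits n} (hx : x ≠ 0) (h0 : w 0 ≠ 0) (hwx : w x ≠ 0) :
    ∃ c : ℂ, c ^ 4 = 1 ∧ 3 / 2 * ‖w 0‖ ^ 2 ≤ ‖w 0 + conj c * w x‖ ^ 2 / 2 := by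
  have hI : (-Complex.I) ^ 4 = 1 := by rw [neg_pow, Complex.I_pow_four]; norm_num
  have hI' := Complex.I_pow_four
  have hm : (-1 : ℂ) ^ 4 = 1 := by norm_num
  have ineq : ∀ c d : ℂ, c ^ 4 = 1 → d ^ 4 = 1 → ‖1 + conj d * c‖ ^ 2 = 2 →
      ‖w 0‖ ^ 2 ≤ ‖w 0 + conj c * w x‖ ^ 2 / 2 + ‖w 0 + conj d * w x‖ ^ 2 / 2 := by
    intro c d hc hd hcd
    by_contra! hlt
    refine hw ⟨ketbra (zeroKet n), pairState x c, pairState x d, isStabilizerPure_basisKet 0,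
      isStabilizerPure_pairKet hx hc, isStabilizerPure_pairKet hx hd,
      trace_zeroKet_mul_pairState hx c, trace_zeroKet_mul_pairState hx d, ?_, ?_⟩
    · rw [trace_pairState_mul_pairState hx, pairKet_self hx, hcd]
      norm_num
    · rw [trace_ketbra_mul_zeroKet, trace_ketbra_mul_pairState, trace_ketbra_mul_pairState]
      exact hlt
  have i1 := ineq 1 Complex.I (by norm_num) hI' (by
    rw [Complex.sq_norm]; norm_num [Complex.normSq_apply])
  have i2 := ineq 1 (-Complex.I) (by norm_num) hI (by
    rw [Complex.sq_norm]; norm_num [Complex.normSq_apply])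
  have i3 := ineq (-1) Complex.I hm hI' (by
    rw [Complex.sq_norm]; norm_num [Complex.normSq_apply])
  have i4 := ineq (-1) (-Complex.I) hm hI (by
    rw [Complex.sq_norm]; norm_num [Complex.normSq_apply])
  by_contra! hlt
  have j1 := hlt 1 (by norm_num)
  have j2 := hlt (-1) hm
  have j3 := hlt Complex.I hI'
  have j4 := hlt (-Complex.I) hI
  have hA : 0 < ‖w 0‖ ^ 2 := by positivity
  have hB : 0 < ‖w x‖ ^ 2 := by positivity
  generalize w 0 = a at *
  generalize w x = b at *
  -- r and s are the real and imaginary parts of conj a · b. The four fidelities are (‖a‖² + ‖b‖² ±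
  -- 2r)/2 and (‖a‖² + ‖b‖² ± 2s)/2, so the undetected inequalities amount to |r| + |s| ≤ ‖b‖².
  obtain ⟨r, hr⟩ : ∃ r, r = a.re * b.re + a.im * b.im := ⟨_, rfl⟩
  obtain ⟨s, hs⟩ : ∃ s, s = a.re * b.im - a.im * b.re := ⟨_, rfl⟩
  have hid : r ^ 2 + s ^ 2 = ‖a‖ ^ 2 * ‖b‖ ^ 2 := by
    rw [hr, hs, Complex.sq_norm, Complex.sq_norm, Complex.normSq_apply, Complex.normSq_apply]
    ring
  have e1 : ‖a + conj 1 * b‖ ^ 2 = ‖a‖ ^ 2 + ‖b‖ ^ 2 + 2 * r := by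
    simp [hr, Complex.sq_norm, Complex.normSq_apply]; ring
  have e2 : ‖a + conj (-1) * b‖ ^ 2 = ‖a‖ ^ 2 + ‖b‖ ^ 2 - 2 * r := by
    simp [hr, Complex.sq_norm, Complex.normSq_apply]; ring
  have e3 : ‖a + conj Complex.I * b‖ ^ 2 = ‖a‖ ^ 2 + ‖b‖ ^ 2 + 2 * s := by
    simp [hs, Complex.sq_norm, Complex.normSq_apply]; ring
  have e4 : ‖a + conj (-Complex.I) * b‖ ^ 2 = ‖a‖ ^ 2 + ‖b‖ ^ 2 - 2 * s := by
    simp [hs, Complex.sq_norm, Complex.normSq_apply]; ring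
  rw [e1, e3] at i1
  rw [e1, e4] at i2
  rw [e2, e3] at i3
  rw [e2, e4] at i4
  rw [e1] at j1
  rw [e2] at j2
  rw [e3] at j3
  rw [e4] at j4
  have k1 : |r| + |s| ≤ ‖b‖ ^ 2 := by
    rcases abs_choice r with h | h <;> rcases abs_choice s with h' | h' <;>
      rw [h, h'] <;> linarith
  have k2 : |r| < ‖a‖ ^ 2 - ‖b‖ ^ 2 / 2 := abs_lt.2 ⟨by linarith, by linarith⟩
  have k3 : |s| < ‖a‖ ^ 2 - ‖b‖ ^ 2 / 2 := abs_lt.2 ⟨by linarith, by linarith⟩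
  exact absurd (exists_large_component hA hB hid k1 k2) (not_le.2 k3)

/-- Iterating the fidelity increase: an undetected nonstabilizer pure state would have arbitrarily
small fidelity with every stabilizer state. -/
lemma fidelity_pow_le {n : ℕ} (k : ℕ) : ∀ w : Bits n → ℂ, ∑ b, ‖w b‖ ^ 2 = 1 →
    ¬ TriangleDetects (ketbra w) → ¬ IsStabilizerPure (ketbra w) → w 0 ≠ 0 →
    (3 / 2 : ℝ) ^ k * ‖w 0‖ ^ 2 ≤ 1 := by
  induction k with
  | zero =>
    intro w hw _ _ _
    rw [pow_zero, one_mul, ← hw]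
    exact Finset.single_le_sum (f := fun b => ‖w b‖ ^ 2) (fun b _ => by positivity)
      (Finset.mem_univ 0)
  | succ k ih =>
    intro w hw hd hs h0
    -- If w were supported at 0 alone, it would be |0⟩ up to a phase, hence stabilizer.
    obtain ⟨x, hx, hwx⟩ : ∃ x, x ≠ 0 ∧ w x ≠ 0 := by
      by_contra! hall
      have hw0 : w = w 0 • zeroKet n := by
        ext b
        by_cases hb : b = 0
        · simp [hb, zeroKet]
        · simp [hall b hb, zeroKet, hb]
      refine hs ?_
      have hn : ‖w 0‖ ^ 2 = 1 := by
        rw [← hw, Finset.sum_eq_single 0 (fun b _ hb => by simp [hall b hb]) (by simp)]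
      rw [hw0, ketbra_smul, hn, Complex.ofReal_one, one_smul]
      exact isStabilizerPure_basisKet 0
    obtain ⟨c, hc, hinc⟩ := exists_fidelity_increase hd hx h0 hwx
    obtain ⟨U, hU, hU0⟩ := exists_clifford_pairKet hx hc
    have hU' := hU.conjTranspose
    -- Applying Uᴴ moves the better neighbour to |0⟩, so its fidelity becomes the new weight at 0
    -- and the induction hypothesis applies.
    have hval : ‖(Uᴴ *ᵥ w) 0‖ ^ 2 = ‖w 0 + conj c * w x‖ ^ 2 / 2 := by
      rw [← star_zeroKet_dotProduct (_ *ᵥ _), Matrix.dotProduct_mulVec, ← Matrix.star_mulVec, hU0,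
        star_smul, smul_dotProduct, star_pairKet_dotProduct, norm_smul, mul_pow, norm_star,
        norm_inv_sqrt_two_sq, one_div_mul_eq_div]
    have hpos : 0 < ‖w 0‖ ^ 2 := by positivity
    have hne : (Uᴴ *ᵥ w) 0 ≠ 0 := fun h => by
      rw [h, norm_zero] at hval
      linarith
    have hback : U * ketbra (Uᴴ *ᵥ w) * Uᴴ = ketbra w := by
      rw [conj_ketbra, Matrix.mulVec_mulVec, hU.mul_conjTranspose_self, Matrix.one_mulVec]
    have := ih (Uᴴ *ᵥ w) ((sum_norm_sq_mulVec hU'.conjTranspose_mul_self w).trans hw)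
      (fun h => hd (.of_conj hU' (by rwa [conj_ketbra])))
      (fun h => hs (by simpa only [hback] using h.conj hU)) hne
    rw [hval] at this
    calc (3 / 2 : ℝ) ^ (k + 1) * ‖w 0‖ ^ 2 = (3 / 2 : ℝ) ^ k * (3 / 2 * ‖w 0‖ ^ 2) := by ring
      _ ≤ _ := (mul_le_mul_of_nonneg_left hinc (by positivity)).trans this

/-- A Clifford moves some nonzero amplitude to position 0. Then `fidelity_pow_le` fails for large k,
since (3/2)^k is unbounded. -/
lemma IsPureState.triangleDetects {n : ℕ} {ρ : Op n} (hρ : IsPureState ρ)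
    (hs : ¬ IsStabilizerPure ρ) : TriangleDetects ρ := by
  obtain ⟨v, hv, rfl⟩ := hρ
  by_contra hd
  obtain ⟨x, hx⟩ : ∃ x, v x ≠ 0 := by
    by_contra! h
    simp [h] at hv
  obtain ⟨U, hU, hU0⟩ := exists_clifford_basisKet x
  have hU' := hU.conjTranspose
  have hval : (Uᴴ *ᵥ v) 0 = v x := by
    rw [← star_zeroKet_dotProduct (_ *ᵥ _), Matrix.dotProduct_mulVec, ← Matrix.star_mulVec, hU0,
      ← Pi.single_star, star_one, single_one_dotProduct]
  have hback : U * ketbra (Uᴴ *ᵥ v) * Uᴴ = ketbra v := by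
    rw [conj_ketbra, Matrix.mulVec_mulVec, hU.mul_conjTranspose_self, Matrix.one_mulVec]
  have hpos : 0 < ‖v x‖ ^ 2 := by positivity
  obtain ⟨k, hk⟩ := pow_unbounded_of_one_lt (1 / ‖v x‖ ^ 2) (show (1 : ℝ) < 3 / 2 by norm_num)
  have := fidelity_pow_le k (Uᴴ *ᵥ v) ((sum_norm_sq_mulVec hU'.conjTranspose_mul_self v).trans hv)
    (fun h => hd (.of_conj hU' (by rwa [conj_ketbra])))
    (fun h => hs (by simpa only [hback] using h.conj hU)) (by rwa [hval])
  rw [hval] at this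
  exact absurd this (not_le.2 ((div_lt_iff₀ hpos).1 hk))

/-! ### Single qubit: the Bloch octahedron -/

/-- The single-qubit operator with Bloch vector `(x, y, z)`. -/
noncomputable def bloch (x y z : ℝ) : Op 1 := Matrix.of fun a b =>
  (!![(1 + z) / 2, (x - y * Complex.I) / 2; (x + y * Complex.I) / 2, (1 - z) / 2] :
    Matrix (Fin 2) (Fin 2) ℂ) (a 0) (b 0)

lemma bits_one_ext {A B : Op 1} (h : ∀ i j : Fin 2, A (fun _ => i) (fun _ => j) =
    B (fun _ => i) (fun _ => j)) : A = B := by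
  ext a b
  have he : ∀ a : Bits 1, a = fun _ => a 0 := fun a => funext fun k => by rw [Fin.fin_one_eq_zero k]
  rw [he a, he b]
  exact h _ _

lemma sum_bits_one (f : Bits 1 → ℂ) : ∑ a, f a = f (fun _ => 0) + f (fun _ => 1) := by
  rw [← (Equiv.funUnique (Fin 1) (Fin 2)).symm.sum_comp, Fin.sum_univ_two]
  rfl

lemma trace_bloch_mul_bloch (x y z x' y' z' : ℝ) :
    (bloch x y z * bloch x' y' z').trace = (((1 + x * x' + y * y' + z * z') / 2 : ℝ) : ℂ) := by
  simp only [Matrix.trace, Matrix.diag_apply, Matrix.mul_apply, sum_bits_one, bloch,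
    Matrix.of_apply, Matrix.cons_val_zero, Matrix.cons_val_one, Matrix.cons_val']
  simp
  linear_combination (-(y : ℂ) * y' / 2) * Complex.I_sq

lemma IsState.exists_bloch {ρ : Op 1} (hρ : IsState ρ) : ∃ x y z : ℝ, ρ = bloch x y z := by
  obtain ⟨hpos, htr⟩ := hρ
  have hH := hpos.isHermitian
  rw [Matrix.trace, sum_bits_one, Matrix.diag_apply, Matrix.diag_apply] at htr
  have h00 := hH.apply (fun _ => 0) (fun _ => 0)
  have h10 := hH.apply (fun _ => 1) (fun _ => 0)
  have i00 := congrArg Complex.im h00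
  simp only [Complex.star_def, Complex.conj_im] at i00
  refine ⟨2 * (ρ (fun _ => 1) (fun _ => 0)).re, 2 * (ρ (fun _ => 1) (fun _ => 0)).im,
    2 * (ρ (fun _ => 0) (fun _ => 0)).re - 1, bits_one_ext fun i j => ?_⟩
  have r := congrArg Complex.re htr
  have im := congrArg Complex.im htr
  have r10 := congrArg Complex.re h10
  have i10 := congrArg Complex.im h10
  simp only [Complex.add_re, Complex.add_im, Complex.one_re, Complex.one_im, Complex.star_def,
    Complex.conj_re, Complex.conj_im] at r im r10 i10
  fin_cases i <;> fin_cases j <;> apply Complex.ext <;> simp [bloch] <;> linarith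

/-- The equatorial point with phase c = x + iy is the state |0⟩ + c|1⟩; this supplies the vertices
on the x and y axes. -/
lemma isStabilizerPure_bloch_pair {x y : ℝ} (h : ((x : ℂ) + y * Complex.I) ^ 4 = 1) :
    IsStabilizerPure (bloch x y 0) := by
  have hx : (fun _ => 1 : Bits 1) ≠ 0 := fun h => by simpa using congrFun h 0
  convert isStabilizerPure_pairKet hx h using 1
  have hn := norm_eq_one_of_fourth_root h
  have hn2 : ((x : ℂ) + y * Complex.I) * (x - y * Complex.I) = 1 := by
    have := Complex.mul_conj' ((x : ℂ) + y * Complex.I)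
    rw [hn] at this
    simpa [sub_eq_add_neg] using this
  rw [ketbra_smul, norm_inv_sqrt_two_sq]
  have h1 : pairKet (fun _ => 1 : Bits 1) ((x : ℂ) + y * Complex.I) (fun _ => 1) = _ :=
    pairKet_self hx _
  have h0 : pairKet (fun _ => 1 : Bits 1) ((x : ℂ) + y * Complex.I) (fun _ => 0) = _ :=
    pairKet_zero hx _
  refine bits_one_ext fun i j => ?_
  fin_cases i <;> fin_cases j <;>
    simp [bloch, ketbra, Matrix.vecMulVec_apply, h0, h1]
  · ring
  · ring
  · linear_combination hn2

lemma isStabilizerPure_bloch_x (e : ℤˣ) : IsStabilizerPure (bloch (e : ℤ) 0 0) := by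
  apply isStabilizerPure_bloch_pair
  rcases Int.units_eq_one_or e with rfl | rfl <;> norm_num

lemma isStabilizerPure_bloch_y (e : ℤˣ) : IsStabilizerPure (bloch 0 (e : ℤ) 0) := by
  apply isStabilizerPure_bloch_pair
  rcases Int.units_eq_one_or e with rfl | rfl <;> norm_num [mul_pow, Complex.I_pow_four]

lemma isStabilizerPure_bloch_z (e : ℤˣ) : IsStabilizerPure (bloch 0 0 (e : ℤ)) := by
  rcases Int.units_eq_one_or e with rfl | rfl
  · convert isStabilizerPure_basisKet (fun _ => 0 : Bits 1) using 1
    refine bits_one_ext fun i j => ?_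
    fin_cases i <;> fin_cases j <;>
      simp [bloch, ketbra, Matrix.vecMulVec_apply, funext_iff]
  · convert isStabilizerPure_basisKet (fun _ => 1 : Bits 1) using 1
    refine bits_one_ext fun i j => ?_
    fin_cases i <;> fin_cases j <;>
      simp [bloch, ketbra, Matrix.vecMulVec_apply, funext_iff]

lemma exists_unit_mul_eq_abs (x : ℝ) : ∃ e : ℤˣ, x * (e : ℤ) = |x| := by
  rcases abs_choice x with h | h
  · exact ⟨1, by simp [h]⟩
  · exact ⟨-1, by simp [h]⟩

/-- Take the x vertex on the same side as the state and the y and z vertices on the opposite sides.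
The violation reads (1 + |x|)/2 > (1 - |y|)/2 + (1 - |z|)/2, which is the hypothesis. -/
lemma triangleDetects_bloch {x y z : ℝ} (h : 1 < |x| + |y| + |z|) :
    TriangleDetects (bloch x y z) := by
  obtain ⟨e, he⟩ := exists_unit_mul_eq_abs x
  obtain ⟨f, hf⟩ := exists_unit_mul_eq_abs y
  obtain ⟨g, hg⟩ := exists_unit_mul_eq_abs z
  refine ⟨_, _, _, isStabilizerPure_bloch_x e, isStabilizerPure_bloch_y (-f),
    isStabilizerPure_bloch_z (-g), ?_, ?_, ?_, ?_⟩
  · rw [trace_bloch_mul_bloch]; simp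
  · rw [trace_bloch_mul_bloch]; simp
  · rw [trace_bloch_mul_bloch]; simp
  · simp only [trace_bloch_mul_bloch, Complex.ofReal_re, Units.val_neg, Int.cast_neg, mul_neg]
    linarith

/-- The Bloch octahedron consists of mixtures of stabilizer states. -/
lemma bloch_mem_stabilizerStates {x y z : ℝ} (h : |x| + |y| + |z| ≤ 1) :
    bloch x y z ∈ stabilizerStates 1 := by
  have hconv := convex_convexHull ℝ {ψ : Op 1 | IsStabilizerPure ψ}
  -- The x and y vertices get total weights |x| and |y|; all the slack goes to the two z vertices,
  -- whose weights are nonnegative because |z| ≤ 1 - |x| - |y|.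
  have key := hconv.sum_mem (t := Finset.univ)
    (w := ![(|x| + x) / 2, (|x| - x) / 2, (|y| + y) / 2, (|y| - y) / 2,
      (1 - |x| - |y| + z) / 2, (1 - |x| - |y| - z) / 2])
    (z := ![bloch (1 : ℤˣ) 0 0, bloch (-1 : ℤˣ) 0 0, bloch 0 (1 : ℤˣ) 0, bloch 0 (-1 : ℤˣ) 0,
      bloch 0 0 (1 : ℤˣ), bloch 0 0 (-1 : ℤˣ)])
    (fun i _ => by
      have := neg_abs_le x
      have := neg_abs_le y
      have := neg_abs_le z
      have := le_abs_self x
      have := le_abs_self y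
      have := le_abs_self z
      fin_cases i <;> simp <;> linarith)
    (by simp [Fin.sum_univ_succ]; ring)
    (fun i _ => by
      apply subset_convexHull
      fin_cases i
      · exact isStabilizerPure_bloch_x 1
      · exact isStabilizerPure_bloch_x (-1)
      · exact isStabilizerPure_bloch_y 1
      · exact isStabilizerPure_bloch_y (-1)
      · exact isStabilizerPure_bloch_z 1
      · exact isStabilizerPure_bloch_z (-1))
  refine Set.mem_of_eq_of_mem ?_ key
  refine bits_one_ext fun i j => ?_
  simp only [Fin.sum_univ_six, Matrix.add_apply, Matrix.smul_apply, bloch, Matrix.of_apply]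
  fin_cases i <;> fin_cases j <;> apply Complex.ext <;> simp <;> ring

end Qubit

theorem theorem1 :
    (∀ (n : ℕ) (ρ : Qubit.Op n), Qubit.IsState ρ → Qubit.TriangleDetects ρ →
      ρ ∉ Qubit.stabilizerStates n) ∧
    (∀ ρ : Qubit.Op 1, Qubit.IsMagic ρ → Qubit.TriangleDetects ρ) ∧
    (∀ (n : ℕ) (ρ : Qubit.Op n), Qubit.IsPureState ρ → Qubit.IsMagic ρ →
      Qubit.TriangleDetects ρ) := by
  refine ⟨fun n ρ _ h => h.notMem_stabilizerStates, fun ρ hρ => ?_, fun n ρ hp hρ => ?_⟩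
  · obtain ⟨x, y, z, rfl⟩ := hρ.1.exists_bloch
    by_contra hd
    exact hρ.2 (Qubit.bloch_mem_stabilizerStates
      (not_lt.1 fun h => hd (Qubit.triangleDetects_bloch h)))
  · exact hp.triangleDetects fun hs => hρ.2 (subset_convexHull ℝ _ hs)
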